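/- A hypergraph $\mathcal H=(X,E)$ consists of a finite non-empty set $X$ and a set $E$ of subsets of $X$ of size at least $2$. It is $r$-uniform if $|e|=r$ for all $e\in E$, and linear if $|e_1\cap e_2|\le 1$ for any two distinct edges $e_1,e_2$. It is connected if any two distinct vertices $u,v$ are covered by the edges of some path, that is, of a sequence of edges $e_1,\dots,e_t$ with $e_i\cap e_{i+1}\neq\emptyset$ for $1\le i<t$. A cycle of length $l\ge 3$ is a subhypergraph consisting of $l$ distinct edges $e_1,\dots,e_l$ for which there are $l$ distinct vertices $v_1,\dots,v_l$ with $v_i\in e_i\cap e_{i+1}$ for $1\le i<l$ and $v_l\in e_l\cap e_1$. A hypergraph is unicyclic if it is connected and contains exactly one cycle. Let $k$ be a non-negative integer and $[k]=\{1,\dots,k\}$. Let $P(\mathcal H,k)$ be the number of maps $f:X\to[k]$ that are not constant on any edge. A $k$-fold cover of $\mathcal H$ is a family $\mathcal F$ of partial maps from $X$ to $[k]$, each with an edge of $\mathcal H$ as its domain, such that any two distinct members of $\mathcal F$ with the same domain are disjoint as subsets of $X\times[k]$. Let $P_{DP}(\mathcal H,\mathcal F)$ be the number of maps $f:X\to[k]$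 that do not extend any $\varphi\in\mathcal F$, and let the DP color function $P_{DP}(\mathcal H,k)$ be the minimum of $P_{DP}(\mathcal H,\mathcal F)$ over all $k$-fold covers $\mathcal F$ of $\mathcal H$. **Theorem.** Let $r\ge 3$, $p\ge 3$ and $m\ge 0$ be integers, and let $\mathcal H$ be a unicyclic linear $r$-uniform hypergraph with $m+p$ edges whose unique cycle has length $p$. 1. If $p$ is odd, then $P_{DP}(\mathcal H,k)=P(\mathcal H,k)$ for every integer $k\ge 0$. 2. If $p$ is even, then $P_{DP}(\mathcal H,k)=(k^{r-1}-1)^{m+p}-(k^{r-1}-1)^{m}$ for every integer $k\ge 0$ with $(k,m)\neq(1,0)$. -/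

import Mathlib

/-! Hypergraphs are Mathlib's `Hypergraph α`: a vertex set and a set of edges, each edge being a
subset of the vertex set. Colors are the elements of `Fin k`. -/

namespace Hypergraph

variable {α : Type*}

/-- Every edge has exactly `r` vertices. -/
def IsUniform (H : Hypergraph α) (r : ℕ) : Prop :=
  ∀ e ∈ H.edgeSet, e.encard = r

/-- Any two distinct edges share at most one vertex. -/
def IsLinear (H : Hypergraph α) : Prop :=
  ∀ e₁ ∈ H.edgeSet, ∀ e₂ ∈ H.edgeSet, e₁ ≠ e₂ → (e₁ ∩ e₂).encard ≤ 1

/-- `P` is the edge sequence `e₁, …, e_t` of a path: consecutive edges intersect. -/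
def IsPath (H : Hypergraph α) (P : List (Set α)) : Prop :=
  (∀ e ∈ P, e ∈ H.edgeSet) ∧ P.IsChain (fun e f => (e ∩ f).Nonempty)

/-- Any two distinct vertices lie on a common path. -/
def IsConnected (H : Hypergraph α) : Prop :=
  ∀ u ∈ H.vertexSet, ∀ v ∈ H.vertexSet, u ≠ v →
    ∃ P, H.IsPath P ∧ (∃ e ∈ P, u ∈ e) ∧ (∃ e ∈ P, v ∈ e)

/-- `C` is the edge set of a (Berge) cycle of length `l ≥ 3` in `H`: it consists of `l` distinct
edges `e i`, in a cyclic order, for which there are `l` distinct vertices `v i`, where `v i` lies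
in both `e i` and `e (i + 1)` (indices modulo `l`). A cycle, as a subhypergraph, is determined by
its edge set. -/
def IsCycle (H : Hypergraph α) (l : ℕ) (C : Set (Set α)) : Prop :=
  3 ≤ l ∧ ∃ (e : ZMod l → Set α) (v : ZMod l → α),
    Function.Injective e ∧ Function.Injective v ∧
    (∀ i, e i ∈ H.edgeSet) ∧ (∀ i, v i ∈ e i ∧ v i ∈ e (i + 1)) ∧ C = Set.range e

/-- Connected, with exactly one cycle (of any length). -/
def IsUnicyclic (H : Hypergraph α) : Prop :=
  H.IsConnected ∧ ∃! C : Set (Set α), ∃ l, H.IsCycle l C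

/-- A proper coloring: no edge is monochromatic. -/
def IsProperColoring (H : Hypergraph α) {k : ℕ} (f : H.vertexSet → Fin k) : Prop :=
  ∀ e ∈ H.edgeSet, ∃ u v : H.vertexSet, (u : α) ∈ e ∧ (v : α) ∈ e ∧ f u ≠ f v

/-- The value `P(H, k)` of the chromatic polynomial: the number of proper `k`-colorings. -/
noncomputable def chromaticFunction (H : Hypergraph α) (k : ℕ) : ℕ :=
  Nat.card {f : H.vertexSet → Fin k // H.IsProperColoring f}

/-- A `k`-fold cover of `H`: a family of partial maps from the vertices to the colors, each having
an edge of `H` as its domain, such that distinct members with the same domain are disjoint as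
subsets of `V(H) × Fin k`. -/
def IsCover (H : Hypergraph α) (k : ℕ) (F : Set (H.vertexSet →. Fin k)) : Prop :=
  (∀ φ ∈ F, Subtype.val '' φ.Dom ∈ H.edgeSet) ∧
  ∀ φ ∈ F, ∀ ψ ∈ F, φ ≠ ψ → φ.Dom = ψ.Dom → Disjoint φ.graph ψ.graph

/-- `f` is an `F`-coloring: it avoids every `φ ∈ F`, that is, no `φ ∈ F` is a restriction of `f`. -/
def IsCoverColoring (H : Hypergraph α) {k : ℕ} (F : Set (H.vertexSet →. Fin k))
    (f : H.vertexSet → Fin k) : Prop :=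
  ∀ φ ∈ F, ¬ ∀ x c, c ∈ φ x → f x = c

/-- `P_DP(H, F)`: the number of `F`-colorings of `H`. -/
noncomputable def coverColoringCount (H : Hypergraph α) {k : ℕ}
    (F : Set (H.vertexSet →. Fin k)) : ℕ :=
  Nat.card {f : H.vertexSet → Fin k // H.IsCoverColoring F f}

/-- The DP color function `P_DP(H, k)`: the minimum of `P_DP(H, F)` over all `k`-fold covers. -/
noncomputable def dpColorFunction (H : Hypergraph α) (k : ℕ) : ℕ :=
  sInf {n | ∃ F : Set (H.vertexSet →. Fin k), H.IsCover k F ∧ n = H.coverColoringCount F}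

/-- The infimum in the definition of `dpColorFunction` is an attained minimum. -/
theorem dpColorFunction_isLeast (H : Hypergraph α) (k : ℕ) :
    IsLeast {n | ∃ F : Set (H.vertexSet →. Fin k), H.IsCover k F ∧ n = H.coverColoringCount F}
      (H.dpColorFunction k) :=
  ⟨Nat.sInf_mem ⟨_, ∅, ⟨by simp, by simp⟩, rfl⟩, fun _ hn => Nat.sInf_le hn⟩

end Hypergraph

/-! Let `k > 0`, `q = k ^ -(r - 1)` and `N = k ^ |V|`. Any cover can be completed to one given by
permutations: on each edge, `k` pairwise disjoint partial maps. Completion only removes colorings,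
so the minimum is taken over permutation covers `π`. The identity cover gives the chromatic
function.

If an edge meets the earlier edges in one vertex, then a proportion `q` of the colorings is bad on
it, independently of what happened before (`colorCount_and_bad`). Linearity makes every acyclic
extension of a connected set of edges grow in this way (`edge_growth`), since a second common vertex
would close a new cycle. The cycle without one edge is acyclic, so all counts on it are products of
`q` and `1 - q`. Turning the edges of the cycle from bad to good one at a time then shows that a
cover affects the number of colorings only through `B`, the number of colorings bad on the whole
cycle (`colorCount_cycle`, `colorCount_eq`): `(1 - q) ^ m * (N * (1 - q) ^ p + (-1) ^ p * (B - N * q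
^ p))`.

For odd `p` the minimum needs the largest `B`, which the identity cover attains
(`colorCount_bad_le`). For even `p` it needs the smallest; a twist at one vertex of one edge gives
`B = 0` when `k ≥ 2` (`exists_colorCount_bad_eq_zero`). The closed form follows from `|V| = (r - 1)
* (m + p)`. -/

namespace Hypergraph

variable {α : Type*}

/-! ### Connectivity through the incidence graph -/

/-- The bipartite graph of incidences between vertices and the edges in `s`. -/
def incidenceGraph (s : Set (Set α)) : SimpleGraph (α ⊕ Set α) where
  Adj
    | .inl x, .inr e => e ∈ s ∧ x ∈ e
    | .inr e, .inl x => e ∈ s ∧ x ∈ e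
    | _, _ => False
  symm := ⟨by rintro (x | e) (y | f) h <;> exact h⟩
  loopless := ⟨by rintro (x | e) h <;> exact h⟩

/-- Two vertices are joined by the edges in `s`. -/
def Joined (s : Set (Set α)) (x y : α) : Prop :=
  (incidenceGraph s).Reachable (.inl x) (.inl y)

theorem Joined.refl (s : Set (Set α)) (x : α) : Joined s x x := SimpleGraph.Reachable.refl _

theorem Joined.symm {s : Set (Set α)} {x y : α} (h : Joined s x y) : Joined s y x :=
  SimpleGraph.Reachable.symm h

theorem Joined.trans {s : Set (Set α)} {x y z : α} (h : Joined s x y) (h' : Joined s y z) :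
    Joined s x z :=
  SimpleGraph.Reachable.trans h h'

theorem Joined.mono {s t : Set (Set α)} (hst : s ⊆ t) {x y : α} (h : Joined s x y) :
    Joined t x y := by
  refine SimpleGraph.Reachable.mono ?_ h
  rintro (x | e) (y | f) h <;> first | exact h | exact ⟨hst h.1, h.2⟩

theorem joined_of_mem {s : Set (Set α)} {e : Set α} (he : e ∈ s) {x y : α} (hx : x ∈ e)
    (hy : y ∈ e) : Joined s x y := by
  have h1 : (incidenceGraph s).Adj (.inl x) (.inr e) := ⟨he, hx⟩
  have h2 : (incidenceGraph s).Adj (.inr e) (.inl y) := ⟨he, hy⟩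
  exact h1.reachable.trans h2.reachable

/-- A property of vertices that is passed on along each edge is passed on along paths. -/
theorem Joined.induct {s : Set (Set α)} {Q : α → Prop}
    (hQ : ∀ e ∈ s, ∀ x ∈ e, ∀ y ∈ e, Q x → Q y) {x y : α} (h : Joined s x y) (hx : Q x) : Q y := by
  have key : ∀ a b : α ⊕ Set α, (incidenceGraph s).Walk a b →
      Sum.elim Q (fun e => e ∈ s ∧ ∀ y ∈ e, Q y) a →
      Sum.elim Q (fun e => e ∈ s ∧ ∀ y ∈ e, Q y) b := by
    intro a b w
    induction w with
    | nil => exact id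
    | @cons a b c h _ ih =>
      refine fun ha => ih ?_
      rcases a with x | e <;> rcases b with y | f
      · exact h.elim
      · exact ⟨h.1, fun y hy => hQ f h.1 x h.2 y hy ha⟩
      · exact ha.2 y h.2
      · exact h.elim
  obtain ⟨w⟩ := h
  exact key _ _ w hx

/-- Any two vertices on the edges in `s` are joined by the edges in `s`. -/
def EdgesConnected (s : Set (Set α)) : Prop :=
  ∀ x ∈ ⋃₀ s, ∀ y ∈ ⋃₀ s, Joined s x y

theorem edgesConnected_singleton (e : Set α) : EdgesConnected {e} := by
  rintro x ⟨_, rfl, hx⟩ y ⟨_, rfl, hy⟩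
  exact joined_of_mem (Set.mem_singleton _) hx hy

theorem EdgesConnected.insert {s : Set (Set α)} (hs : EdgesConnected s) {e : Set α} {u : α}
    (hue : u ∈ e) (hus : u ∈ ⋃₀ s) : EdgesConnected (Insert.insert e s) := by
  have key : ∀ x ∈ ⋃₀ (Insert.insert e s), Joined (Insert.insert e s) x u := by
    rintro x ⟨f, rfl | hf, hx⟩
    · exact joined_of_mem (Set.mem_insert _ _) hx hue
    · exact (hs x ⟨f, hf, hx⟩ u hus).mono (Set.subset_insert _ _)
  exact fun x hx y hy => (key x hx).trans (key y hy).symm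

theorem edgesConnected_chain (F : ℕ → Set α) (X : ℕ → α) (n : ℕ)
    (h : ∀ i < n, X i ∈ F i ∧ X i ∈ F (i + 1)) : EdgesConnected (F '' Set.Iic n) := by
  induction n with
  | zero =>
    have : F '' Set.Iic 0 = {F 0} := by ext; simp [eq_comm]
    rw [this]; exact edgesConnected_singleton _
  | succ n ih =>
    have : F '' Set.Iic (n + 1) = insert (F (n + 1)) (F '' Set.Iic n) := by
      rw [← Set.image_insert_eq]; congr 1; ext i; simp; omega
    rw [this]
    exact (ih fun i hi => h i (by omega)).insert (h n (by omega)).2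
      ⟨F n, ⟨n, by simp, rfl⟩, (h n (by omega)).1⟩

theorem IsConnected.joined {H : Hypergraph α} (h : H.IsConnected) {x y : α}
    (hx : x ∈ H.vertexSet) (hy : y ∈ H.vertexSet) : Joined H.edgeSet x y := by
  by_cases hxy : x = y
  · exact hxy ▸ Joined.refl _ _
  obtain ⟨P, ⟨hP, hc⟩, ⟨e, he, hxe⟩, f, hf, hyf⟩ := h x hx y hy hxy
  have key : EdgesConnected {e | e ∈ P} := by
    clear hP he hf
    induction P with
    | nil => rintro x ⟨e, he, -⟩; simp at he
    | cons e P ih =>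
      have heq : {f | f ∈ e :: P} = insert e {f | f ∈ P} := by ext; simp
      rw [heq]
      cases P with
      | nil => simpa using edgesConnected_singleton e
      | cons f P =>
        rw [List.isChain_cons_cons] at hc
        obtain ⟨u, hu, hu'⟩ := hc.1
        exact (ih hc.2).insert hu ⟨f, by simp, hu'⟩
  exact (key x ⟨e, he, hxe⟩ y ⟨f, hf, hyf⟩).mono hP

/-! ### Berge cycles and one-vertex growth -/

theorem isCycle_of_nat (H : Hypergraph α) (t : ℕ) (ht : 2 ≤ t) (F : ℕ → Set α) (X : ℕ → α)
    (hF : Set.InjOn F (Set.Iic t)) (hX : Set.InjOn X (Set.Iic t))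
    (hE : ∀ i ≤ t, F i ∈ H.edgeSet) (h : ∀ i < t, X i ∈ F i ∧ X i ∈ F (i + 1))
    (ht0 : X t ∈ F t ∧ X t ∈ F 0) : H.IsCycle (t + 1) (F '' Set.Iic t) := by
  -- `ZMod (t + 1)` is `Fin (t + 1)` by definition, so `i + 1` wraps round only at `i = t`.
  refine ⟨by omega, fun i : Fin (t + 1) => F i.1, fun i : Fin (t + 1) => X i.1, ?_, ?_, ?_, ?_, ?_⟩
  · exact fun i j hij => Fin.ext (hF (Nat.le_of_lt_succ i.2) (Nat.le_of_lt_succ j.2) hij)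
  · exact fun i j hij => Fin.ext (hX (Nat.le_of_lt_succ i.2) (Nat.le_of_lt_succ j.2) hij)
  · exact fun i => hE _ (Nat.le_of_lt_succ i.2)
  · suffices hcyc : ∀ i : Fin (t + 1), X i.1 ∈ F i.1 ∧ X i.1 ∈ F (i + 1).1 from hcyc
    intro i
    rcases Nat.lt_or_ge i.1 t with hi | hi
    · have : (i + 1).1 = i.1 + 1 := by
        rw [Fin.val_add, Fin.val_one', Nat.add_mod_mod, Nat.mod_eq_of_lt (by omega)]
      rw [this]; exact h _ hi
    · have hi' : i.1 = t := le_antisymm (Nat.le_of_lt_succ i.2) hi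
      have : (i + 1).1 = 0 := by
        rw [Fin.val_add, Fin.val_one', Nat.add_mod_mod, hi', Nat.mod_self]
      rw [this, hi']; exact ht0
  · ext e
    constructor
    · rintro ⟨i, hi, rfl⟩; exact ⟨(⟨i, Nat.lt_succ_of_le hi⟩ : Fin (t + 1)), rfl⟩
    · rintro ⟨i, rfl⟩; exact ⟨(i : Fin (t + 1)).1, Nat.le_of_lt_succ (i : Fin (t + 1)).2, rfl⟩

/-- A cycle as a periodic sequence of edges and vertices. -/
theorem IsCycle.exists_nat {H : Hypergraph α} {p : ℕ} {C : Set (Set α)} (h : H.IsCycle p C) :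
    ∃ (F : ℕ → Set α) (X : ℕ → α), (∀ i j, F i = F j ↔ i ≡ j [MOD p]) ∧
      (∀ i j, X i = X j ↔ i ≡ j [MOD p]) ∧ (∀ i, F i ∈ H.edgeSet) ∧
      (∀ i, X i ∈ F i ∧ X i ∈ F (i + 1)) ∧ C = F '' Set.Iio p := by
  obtain ⟨hp, e, v, he, hv, hE, h, rfl⟩ := h
  refine ⟨fun i => e i, fun i => v i, fun i j => ?_, fun i j => ?_, fun i => hE _, fun i => ?_, ?_⟩
  · rw [he.eq_iff, ZMod.natCast_eq_natCast_iff]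
  · rw [hv.eq_iff, ZMod.natCast_eq_natCast_iff]
  · simpa using h i
  · have : NeZero p := ⟨by omega⟩
    ext f
    constructor
    · rintro ⟨i, rfl⟩; exact ⟨i.val, ZMod.val_lt i, by simp⟩
    · rintro ⟨i, -, rfl⟩; exact ⟨_, rfl⟩

/-- A path from `u` to `w` in the incidence graph alternates between vertices and edges without
repetition, and `e` closes it to a Berge cycle. Linearity ensures that this cycle has at least three
edges. -/
theorem exists_isCycle_of_joined {H : Hypergraph α} (hlin : H.IsLinear) {s : Set (Set α)}
    (hs : s ⊆ H.edgeSet) {e : Set α} (he : e ∈ H.edgeSet) (hes : e ∉ s) {u w : α} (hu : u ∈ e)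
    (hw : w ∈ e) (huw : u ≠ w) (h : Joined s u w) :
    ∃ l C, H.IsCycle l C ∧ e ∈ C ∧ C ⊆ insert e s := by
  obtain ⟨P, hP⟩ := h.exists_isPath
  have hinj := hP.getVert_injOn
  have hadj : ∀ i < P.length, _ := fun i hi => P.adj_getVert_succ hi
  have hend := P.getVert_length
  have heven : ∀ i, 2 * i ≤ P.length → ∃ x, P.getVert (2 * i) = .inl x := by
    intro i
    induction i with
    | zero => exact fun _ => ⟨u, by simp⟩
    | succ i ih =>
      intro hi
      obtain ⟨x, hx⟩ := ih (by omega)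
      have h1 := hadj (2 * i) (by omega)
      have h2 := hadj (2 * i + 1) (by omega)
      rw [hx] at h1
      rcases h3 : P.getVert (2 * i + 1) with y | f
      · rw [h3] at h1; exact h1.elim
      · rw [h3] at h2
        rcases h4 : P.getVert (2 * i + 1 + 1) with y | g
        · exact ⟨y, rfl⟩
        · rw [h4] at h2; exact h2.elim
  have hodd : ∀ i, 2 * i + 1 ≤ P.length → ∃ f, P.getVert (2 * i + 1) = .inr f := by
    intro i hi
    obtain ⟨x, hx⟩ := heven i (by omega)
    have h1 := hadj (2 * i) (by omega)
    rw [hx] at h1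
    rcases h3 : P.getVert (2 * i + 1) with y | f
    · rw [h3] at h1; exact h1.elim
    · exact ⟨f, rfl⟩
  obtain ⟨t, ht⟩ : ∃ t, P.length = 2 * t := by
    rcases Nat.even_or_odd' P.length with ⟨t, ht | ht⟩
    · exact ⟨t, ht⟩
    · obtain ⟨f, hf⟩ := hodd t (by omega)
      rw [← ht, hend] at hf; cases hf
  have hex : ∃ X : ℕ → α, ∀ i ≤ t, P.getVert (2 * i) = .inl (X i) := by
    have : Nonempty α := ⟨u⟩
    choose! X hX using heven
    exact ⟨X, fun i hi => hX i (by omega)⟩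
  have hef : ∃ G : ℕ → Set α, ∀ i < t, P.getVert (2 * i + 1) = .inr (G i) := by
    choose! G hG using hodd
    exact ⟨G, fun i hi => hG i (by omega)⟩
  obtain ⟨X, hX⟩ := hex
  obtain ⟨G, hG⟩ := hef
  have hXG : ∀ i < t, G i ∈ s ∧ X i ∈ G i ∧ X (i + 1) ∈ G i := by
    intro i hi
    have h1 := hadj (2 * i) (by omega)
    have h2 := hadj (2 * i + 1) (by omega)
    rw [hX i hi.le, hG i hi] at h1
    rw [hG i hi, show 2 * i + 1 + 1 = 2 * (i + 1) by ring, hX (i + 1) hi] at h2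
    exact ⟨h1.1, h1.2, h2.2⟩
  have hX0 : X 0 = u := by have := hX 0 (by omega); simpa using this.symm
  have hXt : X t = w := by
    have := hX t le_rfl; rw [← ht, hend] at this; simpa using this.symm
  have hXinj : ∀ i ≤ t, ∀ j ≤ t, X i = X j → i = j := by
    intro i hi j hj hij
    have := hinj (show 2 * i ≤ P.length by omega) (show 2 * j ≤ P.length by omega)
      (by rw [hX i hi, hX j hj, hij])
    omega
  have hGinj : ∀ i < t, ∀ j < t, G i = G j → i = j := by
    intro i hi j hj hij
    have := hinj (show 2 * i + 1 ≤ P.length by omega) (show 2 * j + 1 ≤ P.length by omega)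
      (by rw [hG i hi, hG j hj, hij])
    omega
  have ht0 : t ≠ 0 := by rintro rfl; exact huw (hX0.symm.trans hXt)
  -- A path through a single edge would make that edge share both `u` and `w` with `e`.
  have ht1 : t ≠ 1 := by
    rintro rfl
    obtain ⟨h1, h2, h3⟩ := hXG 0 (by omega)
    have hne : e ≠ G 0 := by rintro rfl; exact hes h1
    have := Set.encard_le_one_iff.1 (hlin e he (G 0) (hs h1) hne) u w ⟨hu, hX0 ▸ h2⟩ ⟨hw, hXt ▸ h3⟩
    exact huw this
  -- The vertices are shifted by one, because `X (i + 1)` is the one common to `G i` and its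
  -- successor; `u` links the last edge `e` to `G 0`.
  refine ⟨t + 1, _, isCycle_of_nat H t (by omega) (fun i => if i < t then G i else e)
    (fun i => if i < t then X (i + 1) else u) ?_ ?_ ?_ ?_ ?_, ?_, ?_⟩
  · intro i hi j hj hij
    simp only [Set.mem_Iic] at hi hj
    dsimp only at hij
    split_ifs at hij with h1 h2 h2
    · exact hGinj i h1 j h2 hij
    · exact absurd (hij ▸ (hXG i h1).1) hes
    · exact absurd (hij ▸ (hXG j h2).1) hes
    · omega
  · intro i hi j hj hij
    simp only [Set.mem_Iic] at hi hj
    dsimp only at hij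
    rw [← hX0] at hij
    split_ifs at hij with h1 h2 h2
    · have := hXinj _ (by omega) _ (by omega) hij; omega
    · have := hXinj _ (by omega) _ (by omega) hij; omega
    · have := hXinj _ (by omega) _ (by omega) hij; omega
    · omega
  · intro i _
    split_ifs with h1
    · exact hs (hXG i h1).1
    · exact he
  · intro i hi
    rw [if_pos hi, if_pos hi]
    refine ⟨(hXG i hi).2.2, ?_⟩
    split_ifs with h1
    · exact (hXG _ h1).2.1
    · rw [show i + 1 = t by omega, hXt]; exact hw
  · rw [if_neg (lt_irrefl t), if_neg (lt_irrefl t), if_pos (by omega)]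
    exact ⟨hu, hX0 ▸ (hXG 0 (by omega)).2.1⟩
  · exact ⟨t, by simp, by simp⟩
  · rintro _ ⟨i, -, rfl⟩
    dsimp only
    split_ifs with h1
    · exact Or.inr (hXG i h1).1
    · exact Or.inl rfl

/-- If no cycle leaves the connected set `s₀` of edges, then the edges of a connected set can be
added to `s₀` one at a time so that each meets the union of the earlier ones in one vertex. -/
theorem edge_growth {H : Hypergraph α} (hlin : H.IsLinear) {s₀ E : Set (Set α)} (hfin : E.Finite)
    (hs₀E : s₀ ⊆ E) (hE : E ⊆ H.edgeSet) (hne : ∀ e ∈ H.edgeSet, e.Nonempty) (hs₀ : s₀.Nonempty)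
    (hc₀ : EdgesConnected s₀) (hc : EdgesConnected E)
    (hcyc : ∀ l C, H.IsCycle l C → C ⊆ E → C ⊆ s₀) {P : Set (Set α) → Prop} (h₀ : P s₀)
    (step : ∀ s, s₀ ⊆ s → s ⊆ E → ∀ e ∈ E, e ∉ s → ∀ u, e ∩ ⋃₀ s = {u} → P s → P (insert e s)) :
    P E := by
  have key : ∀ n s, s₀ ⊆ s → s ⊆ E → EdgesConnected s → P s → (E \ s).ncard = n → P E := by
    intro n
    induction n with
    | zero =>
      intro s _ hsE _ hP hn
      rw [Set.ncard_eq_zero hfin.sdiff, Set.sdiff_eq_empty] at hn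
      exact hsE.antisymm hn ▸ hP
    | succ n ih =>
      intro s hs hsE hcs hP hn
      obtain ⟨f, hfE, hfs⟩ : (E \ s).Nonempty := (Set.ncard_pos hfin.sdiff).1 (by omega)
      -- Otherwise lying on `s` would be passed on along every edge of `E`, from an edge of `s₀` to
      -- the missing edge `f`.
      obtain ⟨e, heE, hes, u, hue, hus⟩ : ∃ e ∈ E, e ∉ s ∧ ∃ u, u ∈ e ∧ u ∈ ⋃₀ s := by
        by_contra! hcon
        obtain ⟨y, hy⟩ := hne f (hE hfE)
        obtain ⟨g, hg⟩ := hs₀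
        obtain ⟨x, hx⟩ := hne g (hE (hs₀E hg))
        refine hcon f hfE hfs y hy ?_
        refine (hc x ⟨g, hs₀E hg, hx⟩ y ⟨f, hfE, hy⟩).induct (Q := (· ∈ ⋃₀ s)) ?_ ⟨g, hs hg, hx⟩
        intro e he x hx y hy hxs
        by_cases hes : e ∈ s
        · exact ⟨e, hes, hy⟩
        · exact absurd hxs (hcon e he hes x hx)
      -- A second common vertex is joined to `u` by `s`, so `e` would lie on a cycle, hence in `s₀`.
      have hint : e ∩ ⋃₀ s = {u} := by
        refine Set.Subset.antisymm ?_ (by rintro _ rfl; exact ⟨hue, hus⟩)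
        rintro w ⟨hwe, hws⟩
        by_contra hwu
        obtain ⟨l, C, hC, heC, hCs⟩ := exists_isCycle_of_joined hlin (hsE.trans hE) (hE heE) hes
          hue hwe (fun h => hwu h.symm) (hcs u hus w hws)
        exact hes (hs (hcyc l C hC (hCs.trans (Set.insert_subset heE hsE)) heC))
      refine ih (insert e s) (hs.trans (Set.subset_insert _ _)) (Set.insert_subset heE hsE)
        (hcs.insert hue hus) (step s hs hsE e heE hes u hint hP) ?_
      have : E \ s = insert e (E \ insert e s) := by
        ext g; by_cases hge : g = e <;> simp [hge, heE, hes]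
      rw [this, Set.ncard_insert_of_notMem (by simp) hfin.sdiff] at hn
      omega
  exact key _ s₀ subset_rfl hs₀E hc₀ h₀ rfl

/-! ### Counting colorings -/

/-- The number of colorings with a given property, as a rational number. -/
noncomputable def colorCount {V : Type*} {k : ℕ} (S : (V → Fin k) → Prop) : ℚ :=
  (Nat.card {f // S f} : ℚ)

theorem colorCount_nonneg {V : Type*} {k : ℕ} (S : (V → Fin k) → Prop) : 0 ≤ colorCount S :=
  Nat.cast_nonneg _

theorem colorCount_congr {V : Type*} {k : ℕ} {S T : (V → Fin k) → Prop} (h : ∀ f, S f ↔ T f) :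
    colorCount S = colorCount T := by
  rw [funext fun f => propext (h f)]

theorem colorCount_true {V : Type*} [Finite V] {k : ℕ} :
    colorCount (fun _ : V → Fin k => True) = (k : ℚ) ^ Nat.card V := by
  rw [colorCount, Nat.card_congr (Equiv.subtypeUnivEquiv fun _ => trivial), Nat.card_fun]
  simp

theorem colorCount_add {V : Type*} [Finite V] {k : ℕ} (S Q : (V → Fin k) → Prop) :
    colorCount (fun f => S f ∧ Q f) + colorCount (fun f => S f ∧ ¬ Q f) = colorCount S := by
  classical
  unfold colorCount
  rw [← Nat.cast_add, ← Nat.card_sum]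
  congr 1
  refine Nat.card_congr (Equiv.trans (Equiv.sumCongr ?_ ?_)
    (Equiv.sumCompl fun f : {f // S f} => Q f.1))
  · exact (Equiv.subtypeSubtypeEquivSubtypeInter S Q).symm
  · exact (Equiv.subtypeSubtypeEquivSubtypeInter S fun f => ¬ Q f).symm

/-- If the colors on `W` are prescribed by those outside `W`, then the number of colorings is
divided by `k ^ |W|`. -/
theorem card_eq_card_forced_mul {V : Type*} [Finite V] {k : ℕ} (W : Set V)
    (S : (V → Fin k) → Prop) (T : (V → Fin k) → V → Fin k)
    (hS : ∀ f g, (∀ x ∉ W, f x = g x) → S f → S g)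
    (hT : ∀ f g, (∀ x ∉ W, f x = g x) → T f = T g) :
    Nat.card {f // S f} = Nat.card {f // S f ∧ ∀ x ∈ W, f x = T f x} * k ^ W.ncard := by
  classical
  have h1 : ∀ f, ∀ x ∉ W, f x = (fun x => if x ∈ W then T f x else f x) x := by
    intro f x hx; simp [hx]
  have h2 : ∀ (g : V → Fin k) (h : W → Fin k), ∀ x ∉ W,
      g x = (fun x => if hx : x ∈ W then h ⟨x, hx⟩ else g x) x := by
    intro g h x hx; simp [hx]
  -- Overwrite the colors on `W` by the prescribed ones, and remember the original ones separately.
  have e : {f // S f} ≃ {f // S f ∧ ∀ x ∈ W, f x = T f x} × (W → Fin k) :=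
    { toFun := fun f => (⟨fun x => if x ∈ W then T f.1 x else f.1 x, hS _ _ (h1 _) f.2, by
          intro x hx; rw [← hT _ _ (h1 f.1)]; simp [hx]⟩, fun x => f.1 x)
      invFun := fun gh => ⟨fun x => if hx : x ∈ W then gh.2 ⟨x, hx⟩ else gh.1.1 x,
        hS _ _ (h2 _ _) gh.1.2.1⟩
      left_inv := by
        intro f; ext x; by_cases hx : x ∈ W <;> simp [hx]
      right_inv := by
        rintro ⟨⟨g, hg, hg'⟩, h⟩
        refine Prod.ext (Subtype.ext (funext fun x => ?_)) (funext fun x => ?_)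
        · by_cases hx : x ∈ W
          · simp only [hx, if_true]
            rw [← hT _ _ (h2 g h), hg' x hx]
          · simp [hx]
        · simp }
  rw [Nat.card_congr e, Nat.card_prod, Nat.card_fun, Nat.card_coe_set_eq]
  simp

/-! ### Permutation covers and bad edges -/

/-- In the permutation cover `π`, the partial maps with domain `e` are the maps `x ↦ π e x j`, for
the colors `j`. A coloring is bad on `e` if it extends one of them. -/
def Bad {V : Set α} {k : ℕ} (π : Set α → V → Equiv.Perm (Fin k)) (e : Set α) (f : V → Fin k) :
    Prop :=
  ∃ j, ∀ x : V, (x : α) ∈ e → f x = π e x j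

theorem bad_iff {V : Set α} {k : ℕ} (π : Set α → V → Equiv.Perm (Fin k)) (e : Set α)
    (f : V → Fin k) (u : V) (hu : (u : α) ∈ e) :
    Bad π e f ↔ ∀ x : V, (x : α) ∈ e → f x = π e x ((π e u).symm (f u)) := by
  constructor
  · rintro ⟨j, hj⟩ x hx
    rw [hj x hx, hj u hu, Equiv.symm_apply_apply]
  · exact fun h => ⟨_, h⟩

/-- `S` depends only on the colors of the vertices in `A`. -/
def DependsOnly {V : Set α} {k : ℕ} (S : (V → Fin k) → Prop) (A : Set α) : Prop :=
  ∀ f g, (∀ x : V, (x : α) ∈ A → f x = g x) → S f → S g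

/-- Once `u` has its color, badness prescribes the colors of the other `r - 1` vertices of `e`, and
`S` does not see these. -/
theorem colorCount_and_bad {V : Set α} (hV : V.Finite) {k r : ℕ} (hk : 0 < k)
    (π : Set α → V → Equiv.Perm (Fin k)) {S : (V → Fin k) → Prop} {A : Set α}
    (hS : DependsOnly S A) {e : Set α} (he : e ⊆ V) (hr : e.encard = r) {u : α}
    (hu : e ∩ A = {u}) :
    colorCount (fun f => S f ∧ Bad π e f) = ((k : ℚ) ^ (r - 1))⁻¹ * colorCount S := by
  have : Finite V := hV
  have hue : u ∈ e := (hu.symm ▸ Set.mem_singleton u : u ∈ e ∩ A).1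
  let u' : V := ⟨u, he hue⟩
  let W : Set V := {x | (x : α) ∈ e ∧ (x : α) ≠ u}
  have hWA : ∀ x : V, (x : α) ∈ A → x ∉ W := by
    rintro x hx ⟨hxe, hxu⟩
    exact hxu (hu ▸ (⟨hxe, hx⟩ : (x : α) ∈ e ∩ A) : (x : α) ∈ ({u} : Set α))
  have hu'W : u' ∉ W := fun h => h.2 rfl
  have hW : W.ncard = r - 1 := by
    have h1 : Subtype.val '' W = e \ {u} := by
      ext x; constructor
      · rintro ⟨y, hy, rfl⟩; exact hy
      · exact fun hx => ⟨⟨x, he hx.1⟩, hx, rfl⟩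
    rw [← Set.ncard_image_of_injective W Subtype.val_injective, h1,
      Set.ncard_sdiff_singleton_of_mem hue, Set.ncard_def, hr]
    rfl
  have h := card_eq_card_forced_mul W S (fun f x => π e x ((π e u').symm (f u')))
    (fun f g hfg => hS f g fun x hx => hfg x (hWA x hx))
    (fun f g hfg => by simp only [hfg u' hu'W])
  have h2 : colorCount (fun f => S f ∧ Bad π e f) =
      colorCount (fun f => S f ∧ ∀ x ∈ W, f x = π e x ((π e u').symm (f u'))) := by
    refine colorCount_congr fun f => and_congr_right fun _ => ?_
    rw [bad_iff π e f u' hue]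
    refine ⟨fun h x hx => h x hx.1, fun h x hx => ?_⟩
    by_cases hxu : x = u'
    · simp [hxu]
    · exact h x ⟨hx, fun h => hxu (Subtype.ext h)⟩
  have hk0 : (k : ℚ) ^ (r - 1) ≠ 0 := pow_ne_zero _ (by exact_mod_cast hk.ne')
  rw [h2, eq_inv_mul_iff_mul_eq₀ hk0, colorCount, colorCount, h, hW, mul_comm]
  push_cast
  rfl

theorem bad_dependsOnly {V : Set α} {k : ℕ} (π : Set α → V → Equiv.Perm (Fin k)) (e : Set α) :
    DependsOnly (Bad π e) e :=
  fun _ _ hfg ⟨j, hj⟩ => ⟨j, fun x hx => (hfg x hx).symm.trans (hj x hx)⟩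

theorem bad_congr {V : Set α} {k : ℕ} (π : Set α → V → Equiv.Perm (Fin k)) {e : Set α}
    {f g : V → Fin k} (h : ∀ x : V, (x : α) ∈ e → f x = g x) : Bad π e f ↔ Bad π e g :=
  ⟨bad_dependsOnly π e f g h, bad_dependsOnly π e g f fun x hx => (h x hx).symm⟩

/-- Colorings that are bad on a connected set of edges are determined on these edges by one
color. -/
theorem eq_of_bad {V : Set α} {k : ℕ} (π : Set α → V → Equiv.Perm (Fin k))
    {s : Set (Set α)} (hsV : ∀ e ∈ s, e ⊆ V) {f g : V → Fin k} (hf : ∀ e ∈ s, Bad π e f)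
    (hg : ∀ e ∈ s, Bad π e g) {x y : V} (h : Joined s (x : α) y) (hx : f x = g x) : f y = g y := by
  refine (h.induct (Q := fun z => ∀ hz : z ∈ V, f ⟨z, hz⟩ = g ⟨z, hz⟩) ?_ fun _ => hx) y.2
  intro e he a ha b hb hab hbV
  have haV := hsV e he ha
  rw [(bad_iff π e f ⟨a, haV⟩ ha).1 (hf e he) ⟨b, hbV⟩ hb,
    (bad_iff π e g ⟨a, haV⟩ ha).1 (hg e he) ⟨b, hbV⟩ hb, hab haV]

/-- The proportion of colorings that are good on a given edge, or bad on it, according to whether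
the edge belongs to `M`. -/
noncomputable def edgeWeight (q : ℚ) (M : Set (Set α)) (e : Set α) : ℚ :=
  open Classical in if e ∈ M then 1 - q else q

/-- With `M` as the set of edges required to be good, the equivalence treats any pattern of good and
bad edges uniformly. -/
theorem colorCount_and_iff {V : Set α} (hV : V.Finite) {k r : ℕ} (hk : 0 < k)
    (π : Set α → V → Equiv.Perm (Fin k)) (M : Set (Set α)) {S : (V → Fin k) → Prop} {A : Set α}
    (hS : DependsOnly S A) {e : Set α} (he : e ⊆ V) (hr : e.encard = r) {u : α}
    (hu : e ∩ A = {u}) :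
    colorCount (fun f => S f ∧ (e ∈ M ↔ ¬ Bad π e f)) =
      edgeWeight ((k : ℚ) ^ (r - 1))⁻¹ M e * colorCount S := by
  have : Finite V := hV
  have hb := colorCount_and_bad hV hk π hS he hr hu
  have hadd := colorCount_add S (Bad π e)
  unfold edgeWeight
  by_cases heM : e ∈ M
  · simp only [heM, true_iff, if_true]; linarith
  · simpa only [heM, false_iff, not_not, if_false] using hb

/-- Colorings of a connected set of edges without cycles outside `s₀`. -/
theorem colorCount_growth {H : Hypergraph α} (hV : H.vertexSet.Finite) {k r : ℕ} (hk : 0 < k)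
    (hunif : H.IsUniform r) (hr : 1 ≤ r) (hlin : H.IsLinear)
    (π : Set α → H.vertexSet → Equiv.Perm (Fin k)) (M : Set (Set α))
    {s₀ E : Set (Set α)} (hs₀E : s₀ ⊆ E) (hE : E ⊆ H.edgeSet) (hs₀ : s₀.Nonempty)
    (hc₀ : EdgesConnected s₀) (hc : EdgesConnected E)
    (hcyc : ∀ l C, H.IsCycle l C → C ⊆ E → C ⊆ s₀) :
    colorCount (fun f : H.vertexSet → Fin k => ∀ e ∈ E, (e ∈ M ↔ ¬ Bad π e f)) =
      (∏ᶠ e ∈ E \ s₀, edgeWeight ((k : ℚ) ^ (r - 1))⁻¹ M e) *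
        colorCount (fun f : H.vertexSet → Fin k => ∀ e ∈ s₀, (e ∈ M ↔ ¬ Bad π e f)) := by
  have hfin : E.Finite := (hV.finite_subsets.subset fun e he =>
    H.subset_vertexSet_of_mem_edgeSet' (hE he))
  have hne : ∀ e ∈ H.edgeSet, e.Nonempty := by
    intro e he
    rw [← Set.encard_pos, hunif e he]; exact_mod_cast hr
  refine edge_growth (P := fun s => colorCount (fun f : H.vertexSet → Fin k =>
    ∀ e ∈ s, (e ∈ M ↔ ¬ Bad π e f)) = (∏ᶠ e ∈ s \ s₀, edgeWeight ((k : ℚ) ^ (r - 1))⁻¹ M e) *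
        colorCount (fun f : H.vertexSet → Fin k => ∀ e ∈ s₀, (e ∈ M ↔ ¬ Bad π e f)))
    hlin hfin hs₀E hE hne hs₀ hc₀ hc hcyc ?_ ?_
  · simp
  · intro s hs hsE e heE hes u hu ih
    have h1 : insert e s \ s₀ = insert e (s \ s₀) :=
      Set.insert_sdiff_of_notMem _ fun h => hes (hs h)
    rw [h1, finprod_mem_insert _ (fun h => hes h.1) (hfin.subset (Set.sdiff_subset.trans hsE)),
      mul_assoc, ← ih, ← colorCount_and_iff hV hk π M (A := ⋃₀ s) (e := e) ?_
        (H.subset_vertexSet_of_mem_edgeSet' (hE heE)) (hunif e (hE heE)) hu]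
    · refine colorCount_congr fun f => ?_
      rw [Set.forall_mem_insert, and_comm]
    · intro f g hfg hf e he
      rw [hf e he, bad_congr π fun x hx => hfg x ⟨e, he, hx⟩]

theorem ncard_sUnion_growth {H : Hypergraph α} (hV : H.vertexSet.Finite) {r : ℕ}
    (hunif : H.IsUniform r) (hr : 1 ≤ r) (hlin : H.IsLinear)
    {s₀ E : Set (Set α)} (hs₀E : s₀ ⊆ E) (hE : E ⊆ H.edgeSet) (hs₀ : s₀.Nonempty)
    (hc₀ : EdgesConnected s₀) (hc : EdgesConnected E)
    (hcyc : ∀ l C, H.IsCycle l C → C ⊆ E → C ⊆ s₀) :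
    (⋃₀ E).ncard = (⋃₀ s₀).ncard + (r - 1) * (E \ s₀).ncard := by
  have hfin : E.Finite := (hV.finite_subsets.subset fun e he =>
    H.subset_vertexSet_of_mem_edgeSet' (hE he))
  have hne : ∀ e ∈ H.edgeSet, e.Nonempty := by
    intro e he
    rw [← Set.encard_pos, hunif e he]; exact_mod_cast hr
  refine edge_growth (P := fun s => (⋃₀ s).ncard = (⋃₀ s₀).ncard + (r - 1) * (s \ s₀).ncard)
    hlin hfin hs₀E hE hne hs₀ hc₀ hc hcyc ?_ ?_
  · simp
  · intro s hs hsE e heE hes u hu ih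
    have h1 : insert e s \ s₀ = insert e (s \ s₀) :=
      Set.insert_sdiff_of_notMem _ fun h => hes (hs h)
    have hsub : ∀ e ∈ E, e ⊆ H.vertexSet := fun e he => H.subset_vertexSet_of_mem_edgeSet' (hE he)
    have h2 := Set.ncard_union_add_ncard_inter e (⋃₀ s) (hV.subset (hsub e heE))
      (hV.subset (Set.sUnion_subset fun f hf => hsub f (hsE hf)))
    have h3 : e.ncard = r := by rw [Set.ncard_def, hunif e (hE heE)]; rfl
    rw [h1, Set.ncard_insert_of_notMem (fun h => hes h.1)
      (hfin.subset (Set.sdiff_subset.trans hsE)), Set.sUnion_insert, mul_add]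
    rw [hu, Set.ncard_singleton, h3] at h2
    omega

/-! ### The unique cycle -/

/-- `F` and `X` are periodic sequences of edges and vertices that run along the only cycle `C`. -/
structure UniqueCycle (H : Hypergraph α) (p : ℕ) (C : Set (Set α)) (F : ℕ → Set α) (X : ℕ → α) :
    Prop where
  three_le : 3 ≤ p
  edge_eq_iff : ∀ i j, F i = F j ↔ i ≡ j [MOD p]
  vertex_eq_iff : ∀ i j, X i = X j ↔ i ≡ j [MOD p]
  mem_edgeSet : ∀ i, F i ∈ H.edgeSet
  mem : ∀ i, X i ∈ F i ∧ X i ∈ F (i + 1)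
  eq_image : C = F '' Set.Iio p
  unique : ∀ l C', H.IsCycle l C' → C' = C

namespace UniqueCycle

variable {H : Hypergraph α} {p : ℕ} {C : Set (Set α)} {F : ℕ → Set α} {X : ℕ → α}

theorem edge_mem (h : UniqueCycle H p C F X) (i : ℕ) : F i ∈ C := by
  rw [h.eq_image]
  refine ⟨i % p, Nat.mod_lt _ (by have := h.three_le; omega), ?_⟩
  rw [h.edge_eq_iff]; exact Nat.mod_modEq _ _

theorem subset_edgeSet (h : UniqueCycle H p C F X) : C ⊆ H.edgeSet := by
  rw [h.eq_image]; rintro _ ⟨i, -, rfl⟩; exact h.mem_edgeSet i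

theorem injOn (h : UniqueCycle H p C F X) : Set.InjOn F (Set.Iio p) := fun i hi j hj hij =>
  Nat.ModEq.eq_of_lt_of_lt ((h.edge_eq_iff i j).1 hij) hi hj

theorem ncard_eq (h : UniqueCycle H p C F X) : C.ncard = p := by
  rw [h.eq_image, h.injOn.ncard_image, ← Finset.coe_Iio, Set.ncard_coe_finset,
    Nat.card_Iio]

/-- By periodicity, the cycle opened at any edge is a run of `p - 1` consecutive edges that starts
right after it. -/
theorem diff_eq (h : UniqueCycle H p C F X) {i : ℕ} (hi : i < p) :
    C \ {F i} = (fun t => F (i + 1 + t)) '' Set.Iic (p - 2) := by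
  have hp := h.three_le
  ext e
  constructor
  · rintro ⟨he, hei⟩
    rw [h.eq_image] at he
    obtain ⟨j, hj, rfl⟩ := he
    have hj : j < p := hj
    have hji : j ≠ i := by rintro rfl; exact hei rfl
    rcases Nat.lt_or_ge i j with hij | hij
    · exact ⟨j - i - 1, show _ ≤ p - 2 by omega, by dsimp only; congr 1; omega⟩
    · refine ⟨j + p - i - 1, show _ ≤ p - 2 by omega, ?_⟩
      dsimp only
      rw [show i + 1 + (j + p - i - 1) = j + p by omega, h.edge_eq_iff]
      simp
  · rintro ⟨t, ht, rfl⟩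
    have ht : t ≤ p - 2 := ht
    refine ⟨h.edge_mem _, fun heq => ?_⟩
    have := (h.edge_eq_iff _ _).1 (Set.mem_singleton_iff.1 heq)
    rw [add_assoc] at this
    have h0 : (1 + t) ≡ 0 [MOD p] := Nat.ModEq.add_left_cancel' i this
    have := Nat.ModEq.eq_of_lt_of_lt h0 (by omega) (by omega)
    omega

theorem edgesConnected_diff (h : UniqueCycle H p C F X) {i : ℕ} (hi : i < p) :
    EdgesConnected (C \ {F i}) := by
  rw [h.diff_eq hi]
  exact edgesConnected_chain _ (fun t => X (i + 1 + t)) _ fun t _ => h.mem _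

theorem edgesConnected (h : UniqueCycle H p C F X) : EdgesConnected C := by
  have : C = F '' Set.Iic (p - 1) := by
    rw [h.eq_image]; congr 1; ext i; have := h.three_le; simp; omega
  rw [this]
  exact edgesConnected_chain _ X _ fun t _ => h.mem _

/-- The premise is contradictory, as the only cycle contains `F i`. The set `s` is arbitrary so as
to match the acyclicity hypothesis of the growth lemmas. -/
theorem not_subset_diff (h : UniqueCycle H p C F X) (i : ℕ) {s : Set (Set α)} (l : ℕ)
    (C' : Set (Set α)) (hC' : H.IsCycle l C') (hs : C' ⊆ C \ {F i}) : C' ⊆ s :=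
  absurd rfl ((hs (h.unique l C' hC' ▸ h.edge_mem i)).2)

/-- The opened cycle is acyclic, so its edges behave independently whatever the cover is. -/
theorem colorCount_path (h : UniqueCycle H p C F X) (hV : H.vertexSet.Finite) {k r : ℕ}
    (hk : 0 < k) (hunif : H.IsUniform r) (hr : 1 ≤ r) (hlin : H.IsLinear)
    (π : Set α → H.vertexSet → Equiv.Perm (Fin k)) (M : Set (Set α)) {i : ℕ} (hi : i < p) :
    colorCount (fun f : H.vertexSet → Fin k => ∀ e ∈ C \ {F i}, (e ∈ M ↔ ¬ Bad π e f)) =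
      (∏ᶠ e ∈ C \ {F i}, edgeWeight ((k : ℚ) ^ (r - 1))⁻¹ M e) *
        (k : ℚ) ^ Nat.card H.vertexSet := by
  have : Finite H.vertexSet := hV
  have hmem : F (i + 1) ∈ C \ {F i} := by
    rw [h.diff_eq hi]; exact ⟨0, by simp, by simp⟩
  have hsub : C \ {F i} ⊆ H.edgeSet := Set.sdiff_subset.trans h.subset_edgeSet
  have hfin : (C \ {F i}).Finite := (hV.finite_subsets.subset fun e he =>
    H.subset_vertexSet_of_mem_edgeSet' (hsub he))
  have hg := colorCount_growth hV hk hunif hr hlin π M (s₀ := {F (i + 1)})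
    (Set.singleton_subset_iff.2 hmem) hsub (Set.singleton_nonempty _)
    (edgesConnected_singleton _) (h.edgesConnected_diff hi) (h.not_subset_diff i)
  -- The first edge gets its weight too: it is grown from the single vertex `X i` and the empty
  -- condition.
  have h1 := colorCount_and_iff hV hk π M (S := fun _ => True) (A := {X i}) (e := F (i + 1))
    (u := X i) (fun _ _ _ h => h) (H.subset_vertexSet_of_mem_edgeSet' (h.mem_edgeSet _))
    (hunif _ (h.mem_edgeSet _))
    (Set.inter_eq_right.2 (Set.singleton_subset_iff.2 (h.mem i).2))
  rw [colorCount_true] at h1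
  have h2 : C \ {F i} = insert (F (i + 1)) ((C \ {F i}) \ {F (i + 1)}) := by
    rw [Set.insert_sdiff_singleton, Set.insert_eq_of_mem hmem]
  rw [hg]
  conv_rhs => rw [h2, finprod_mem_insert _ (by simp) hfin.sdiff, mul_comm (edgeWeight _ _ _),
    mul_assoc, ← h1]
  congr 1
  exact colorCount_congr fun f => by simp

theorem finprod_edgeWeight (h : UniqueCycle H p C F X) (q : ℚ) {i : ℕ} (hi : i < p) :
    ∏ᶠ e ∈ C \ {F i}, edgeWeight q (F '' Set.Iio i) e = (1 - q) ^ i * q ^ (p - 1 - i) := by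
  have hset : C \ {F i} = F '' (((Finset.range p).erase i : Finset ℕ) : Set ℕ) := by
    ext e
    rw [h.eq_image]
    constructor
    · rintro ⟨⟨j, hj, rfl⟩, hji⟩
      exact ⟨j, by simpa using ⟨hj, fun hji' => hji (by rw [hji']; rfl)⟩, rfl⟩
    · rintro ⟨j, hj, rfl⟩
      have hj' : j < p ∧ j ≠ i := by simpa using hj
      exact ⟨⟨j, hj'.1, rfl⟩, fun heq => hj'.2 (h.injOn hj'.1 hi heq)⟩
  have hsub : (((Finset.range p).erase i : Finset ℕ) : Set ℕ) ⊆ Set.Iio p := by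
    intro j hj
    have hj' : j < p ∧ j ≠ i := by simpa using hj
    exact hj'.1
  rw [hset, finprod_mem_image (h.injOn.mono hsub), finprod_mem_coe_finset]
  have hw : ∀ j ∈ (Finset.range p).erase i, edgeWeight q (F '' Set.Iio i) (F j) =
      if j < i then 1 - q else q := by
    intro j hj
    have hj' : j < p := hsub hj
    unfold edgeWeight
    have : F j ∈ F '' Set.Iio i ↔ j < i := by
      constructor
      · rintro ⟨a, ha, hab⟩
        have ha : a < i := ha
        rwa [← h.injOn (show a < p by omega) hj' hab]
      · exact fun hji => ⟨j, hji, rfl⟩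
    simp only [this]
  rw [Finset.prod_congr rfl hw, Finset.prod_ite, Finset.prod_const, Finset.prod_const]
  have h1 : ((Finset.range p).erase i).filter (fun j => j < i) = Finset.range i := by
    ext j; simp; omega
  have h2 : ((Finset.range p).erase i).filter (fun j => ¬ j < i) = Finset.Ioo i p := by
    ext j; simp; omega
  rw [h1, h2, Finset.card_range, Nat.card_Ioo, Nat.sub_right_comm]

/-- The count with the first `i` edges good and the others bad, plus the count with `F i` also good,
is a count on the path without `F i`, hence known. The deviation from the independent value `N * (1
- q) ^ i * q ^ (p - i)` therefore just changes sign at each step, starting from `B - N * q ^ p`. -/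
theorem colorCount_cycle (h : UniqueCycle H p C F X) (hV : H.vertexSet.Finite) {k r : ℕ}
    (hk : 0 < k) (hunif : H.IsUniform r) (hr : 1 ≤ r) (hlin : H.IsLinear)
    (π : Set α → H.vertexSet → Equiv.Perm (Fin k)) :
    colorCount (fun f : H.vertexSet → Fin k => ∀ e ∈ C, ¬ Bad π e f) =
      (k : ℚ) ^ Nat.card H.vertexSet * (1 - ((k : ℚ) ^ (r - 1))⁻¹) ^ p +
      (-1) ^ p * (colorCount (fun f : H.vertexSet → Fin k => ∀ e ∈ C, Bad π e f) -
        (k : ℚ) ^ Nat.card H.vertexSet * ((k : ℚ) ^ (r - 1))⁻¹ ^ p) := by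
  have : Finite H.vertexSet := hV
  set q : ℚ := ((k : ℚ) ^ (r - 1))⁻¹ with hq
  set N : ℚ := (k : ℚ) ^ Nat.card H.vertexSet
  set B := colorCount (fun f : H.vertexSet → Fin k => ∀ e ∈ C, Bad π e f) with hB
  have key : ∀ i ≤ p, colorCount (fun f : H.vertexSet → Fin k =>
      ∀ e ∈ C, (e ∈ F '' Set.Iio i ↔ ¬ Bad π e f)) =
      N * ((1 - q) ^ i * q ^ (p - i)) + (-1) ^ i * (B - N * q ^ p) := by
    intro i
    induction i with
    | zero =>
      intro _
      have : colorCount (fun f : H.vertexSet → Fin k =>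
          ∀ e ∈ C, (e ∈ F '' Set.Iio 0 ↔ ¬ Bad π e f)) = B := by
        refine colorCount_congr fun f => ?_
        simp
      rw [this]; simp
    | succ i ih =>
      intro hi
      have hnot : F i ∉ F '' Set.Iio i := by
        rintro ⟨a, ha, hab⟩
        have ha : a < i := ha
        have := h.injOn (show a < p by omega) (show i < p by omega) hab
        omega
      have hIio : F '' Set.Iio (i + 1) = insert (F i) (F '' Set.Iio i) := by
        rw [← Set.image_insert_eq]; congr 1; ext j; simp
      have hC : C = insert (F i) (C \ {F i}) := by
        rw [Set.insert_sdiff_singleton, Set.insert_eq_of_mem (h.edge_mem i)]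
      have hpath := h.colorCount_path hV hk hunif hr hlin π (F '' Set.Iio i) (i := i) (by omega)
      rw [← hq, h.finprod_edgeWeight q (by omega)] at hpath
      have hadd := colorCount_add (fun f : H.vertexSet → Fin k =>
        ∀ e ∈ C \ {F i}, (e ∈ F '' Set.Iio i ↔ ¬ Bad π e f)) (Bad π (F i))
      have h1 : colorCount (fun f : H.vertexSet → Fin k =>
          (∀ e ∈ C \ {F i}, (e ∈ F '' Set.Iio i ↔ ¬ Bad π e f)) ∧ Bad π (F i) f) =
          colorCount (fun f : H.vertexSet → Fin k =>
            ∀ e ∈ C, (e ∈ F '' Set.Iio i ↔ ¬ Bad π e f)) := by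
        refine colorCount_congr fun f => ?_
        conv_rhs => rw [hC, Set.forall_mem_insert, iff_false_left hnot, not_not, and_comm]
      have h2 : colorCount (fun f : H.vertexSet → Fin k =>
          (∀ e ∈ C \ {F i}, (e ∈ F '' Set.Iio i ↔ ¬ Bad π e f)) ∧ ¬ Bad π (F i) f) =
          colorCount (fun f : H.vertexSet → Fin k =>
            ∀ e ∈ C, (e ∈ F '' Set.Iio (i + 1) ↔ ¬ Bad π e f)) := by
        refine colorCount_congr fun f => ?_
        conv_rhs => rw [hC, Set.forall_mem_insert, hIio, iff_true_left (Set.mem_insert _ _),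
          and_comm]
        refine and_congr_left fun _ => forall₂_congr fun e he => ?_
        rw [Set.mem_insert_iff, or_iff_right (show e ≠ F i from he.2)]
      rw [h1, h2, ih (by omega), hpath, show p - i = p - 1 - i + 1 by omega] at hadd
      rw [show p - (i + 1) = p - 1 - i by omega]
      rw [pow_succ] at hadd
      rw [pow_succ (1 - q), pow_succ (-1 : ℚ)]
      linear_combination hadd
  have := key p le_rfl
  rw [Nat.sub_self, pow_zero, mul_one] at this
  rw [← this]
  refine colorCount_congr fun f => forall₂_congr fun e he => ?_
  rw [← h.eq_image, iff_true_left he]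

/-- Each of the `m` edges off the cycle is attached at one vertex and contributes a factor `1 - q`,
so the cover enters only through the colorings that are bad on all of `C`. -/
theorem colorCount_eq (h : UniqueCycle H p C F X) (hV : H.vertexSet.Finite) {k r m : ℕ}
    (hk : 0 < k) (hunif : H.IsUniform r) (hr : 1 ≤ r) (hlin : H.IsLinear)
    (hcon : EdgesConnected H.edgeSet) (hcard : H.edgeSet.ncard = m + p)
    (π : Set α → H.vertexSet → Equiv.Perm (Fin k)) :
    colorCount (fun f : H.vertexSet → Fin k => ∀ e ∈ H.edgeSet, ¬ Bad π e f) =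
      (1 - ((k : ℚ) ^ (r - 1))⁻¹) ^ m *
      ((k : ℚ) ^ Nat.card H.vertexSet * (1 - ((k : ℚ) ^ (r - 1))⁻¹) ^ p +
      (-1) ^ p * (colorCount (fun f : H.vertexSet → Fin k => ∀ e ∈ C, Bad π e f) -
        (k : ℚ) ^ Nat.card H.vertexSet * ((k : ℚ) ^ (r - 1))⁻¹ ^ p)) := by
  have hfin : H.edgeSet.Finite := (hV.finite_subsets.subset fun e he =>
    H.subset_vertexSet_of_mem_edgeSet' he)
  have hg := colorCount_growth hV hk hunif hr hlin π Set.univ h.subset_edgeSet subset_rfl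
    ⟨_, h.edge_mem 0⟩ h.edgesConnected hcon fun l C' hC' _ => (h.unique l C' hC').subset
  simp only [Set.mem_univ, true_iff] at hg
  rw [hg, h.colorCount_cycle hV hk hunif hr hlin π]
  congr 1
  have hd : (H.edgeSet \ C).ncard = m := by
    have := Set.ncard_sdiff_add_ncard_of_subset h.subset_edgeSet hfin
    rw [h.ncard_eq] at this
    omega
  rw [finprod_mem_eq_finite_toFinset_prod _ hfin.sdiff,
    Finset.prod_congr rfl (g := fun _ => 1 - ((k : ℚ) ^ (r - 1))⁻¹) (fun e _ => by
      simp [edgeWeight]), Finset.prod_const, ← Set.ncard_eq_toFinset_card _ hfin.sdiff, hd]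

theorem inter_sUnion_diff (h : UniqueCycle H p C F X) (hlin : H.IsLinear) :
    F (p - 1) ∩ ⋃₀ (C \ {F (p - 1)}) = {X (p - 2), X (p - 1)} := by
  have hp := h.three_le
  have hne : ∀ j < p - 1, F j ≠ F (p - 1) := by
    intro j hj heq
    have := h.injOn (show j < p by omega) (show p - 1 < p by omega) heq
    omega
  have hX2 := h.mem (p - 2)
  rw [show p - 2 + 1 = p - 1 by omega] at hX2
  have hX1 := h.mem (p - 1)
  have hF0 : F (p - 1 + 1) = F 0 := by
    rw [h.edge_eq_iff, show p - 1 + 1 = p by omega]; simp [Nat.ModEq]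
  rw [hF0] at hX1
  ext w
  constructor
  · rintro ⟨hw, e, ⟨he, hep⟩, hwe⟩
    by_contra hcon
    simp only [Set.mem_insert_iff, Set.mem_singleton_iff, not_or] at hcon
    rw [h.eq_image] at he
    obtain ⟨j, hj, rfl⟩ := he
    have hj : j < p := hj
    have hjp : j ≠ p - 1 := by rintro rfl; exact hep rfl
    rcases Nat.eq_zero_or_pos j with rfl | hj0
    -- On `F 0`, linearity leaves only `X (p - 1)`.
    · exact hcon.2 (Set.encard_le_one_iff.1 (hlin _ (h.mem_edgeSet _) _ (h.mem_edgeSet _)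
        (hne 0 (by omega))) w (X (p - 1)) ⟨hwe, hw⟩ ⟨hX1.2, hX1.1⟩)
    -- On a middle edge, the chain `F 1, …, F (p - 2)` joins `w` to `X (p - 2)`; closing it by `F (p
    -- - 1)` gives a cycle that avoids `F 0`, against uniqueness.
    · have hconn := edgesConnected_chain (fun t => F (t + 1)) (fun t => X (t + 1)) (p - 3)
        fun t _ => h.mem _
      have hsub : (fun t => F (t + 1)) '' Set.Iic (p - 3) ⊆ H.edgeSet := by
        rintro _ ⟨i, -, rfl⟩; exact h.mem_edgeSet _
      have hnot : ∀ i, (i = 0 ∨ i = p - 1) → F i ∉ (fun t => F (t + 1)) '' Set.Iic (p - 3) := by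
        rintro i hi ⟨t, ht, hti⟩
        have ht : t ≤ p - 3 := ht
        have := h.injOn (show t + 1 < p by omega) (show i < p by omega) hti
        omega
      obtain ⟨l, C', hC', -, hsub'⟩ := exists_isCycle_of_joined hlin hsub (h.mem_edgeSet (p - 1))
        (hnot _ (Or.inr rfl)) hw hX2.2 hcon.1
        (hconn w ⟨F j, ⟨j - 1, show _ ≤ p - 3 by omega, by dsimp only; congr 1; omega⟩, hwe⟩
          (X (p - 2)) ⟨F (p - 2), ⟨p - 3, le_refl (p - 3), by dsimp only; congr 1; omega⟩, hX2.1⟩)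
      rw [h.unique l C' hC'] at hsub'
      rcases hsub' (h.edge_mem 0) with h0 | h0
      · exact hne 0 (by omega) h0
      · exact hnot 0 (Or.inl rfl) h0
  · rintro (rfl | rfl)
    · exact ⟨hX2.2, F (p - 2), ⟨h.edge_mem _, hne _ (by omega)⟩, hX2.1⟩
    · exact ⟨hX1.1, F 0, ⟨h.edge_mem _, hne _ (by omega)⟩, hX1.2⟩

theorem vertex_ne (h : UniqueCycle H p C F X) : X (p - 2) ≠ X (p - 1) := by
  have hp := h.three_le
  intro heq
  have := Nat.ModEq.eq_of_lt_of_lt ((h.vertex_eq_iff _ _).1 heq) (by omega) (by omega)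
  omega

/-- The cycle without its last edge has `r + (r - 1) * (p - 2)` vertices, the last edge adds `r -
2`, and each of the other `m` edges adds `r - 1`. -/
theorem card_vertexSet (h : UniqueCycle H p C F X) (hV : H.vertexSet.Finite) {r m : ℕ}
    (hunif : H.IsUniform r) (hr : 1 ≤ r) (hlin : H.IsLinear)
    (hcon : EdgesConnected H.edgeSet) (hcov : ⋃₀ H.edgeSet = H.vertexSet)
    (hcard : H.edgeSet.ncard = m + p) : Nat.card H.vertexSet = (r - 1) * (m + p) := by
  have hp := h.three_le
  have hfin : H.edgeSet.Finite := (hV.finite_subsets.subset fun e he =>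
    H.subset_vertexSet_of_mem_edgeSet' he)
  have hefin : ∀ e ∈ H.edgeSet, e.Finite := fun e he =>
    hV.subset (H.subset_vertexSet_of_mem_edgeSet' he)
  have hn : ∀ e ∈ H.edgeSet, e.ncard = r := fun e he => by rw [Set.ncard_def, hunif e he]; rfl
  have hmem : F (p - 1 + 1) ∈ C \ {F (p - 1)} := by
    rw [h.diff_eq (by omega)]; exact ⟨0, by simp, by simp⟩
  have hsub : C \ {F (p - 1)} ⊆ H.edgeSet := Set.sdiff_subset.trans h.subset_edgeSet
  have h1 := ncard_sUnion_growth hV hunif hr hlin (s₀ := {F (p - 1 + 1)})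
    (Set.singleton_subset_iff.2 hmem) hsub (Set.singleton_nonempty _)
    (edgesConnected_singleton _) (h.edgesConnected_diff (by omega)) (h.not_subset_diff (p - 1))
  have h2 := ncard_sUnion_growth hV hunif hr hlin h.subset_edgeSet subset_rfl
    ⟨_, h.edge_mem 0⟩ h.edgesConnected hcon fun l C' hC' _ => (h.unique l C' hC').subset
  have hC : C = insert (F (p - 1)) (C \ {F (p - 1)}) := by
    rw [Set.insert_sdiff_singleton, Set.insert_eq_of_mem (h.edge_mem _)]
  have h3 := Set.ncard_union_add_ncard_inter (F (p - 1)) (⋃₀ (C \ {F (p - 1)}))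
    (hefin _ (h.mem_edgeSet _))
    ((hfin.subset hsub).sUnion fun e he => hefin e (hsub he))
  rw [h.inter_sUnion_diff hlin, Set.ncard_pair h.vertex_ne, ← Set.sUnion_insert, ← hC,
    hn _ (h.mem_edgeSet _), h1, Set.sUnion_singleton, hn _ (h.mem_edgeSet _),
    Set.ncard_sdiff_singleton_of_mem hmem, Set.ncard_sdiff_singleton_of_mem (h.edge_mem _),
    h.ncard_eq] at h3
  have hd : (H.edgeSet \ C).ncard = m := by
    have := Set.ncard_sdiff_add_ncard_of_subset h.subset_edgeSet hfin
    rw [h.ncard_eq] at this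
    omega
  rw [hcov, hd] at h2
  rw [Nat.card_coe_set_eq, h2, mul_add]
  obtain ⟨s, rfl⟩ : ∃ s, r = s + 1 := ⟨r - 1, by omega⟩
  obtain ⟨t, rfl⟩ : ∃ t, p = t + 2 := ⟨p - 2, by omega⟩
  simp only [Nat.add_sub_cancel, show t + 2 - 1 - 1 = t by omega] at h3 ⊢
  rw [mul_add s t 2]
  omega

/-- A coloring bad on all of `C` is determined on `⋃₀ C` by its color at `X 0`. Repainting `⋃₀ C`
with that color is thus injective, and the result is bad for the identity cover. -/
theorem colorCount_bad_le (h : UniqueCycle H p C F X) (hV : H.vertexSet.Finite) {k : ℕ}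
    (π : Set α → H.vertexSet → Equiv.Perm (Fin k)) :
    colorCount (fun f : H.vertexSet → Fin k => ∀ e ∈ C, Bad π e f) ≤
      colorCount (fun f : H.vertexSet → Fin k => ∀ e ∈ C, Bad (fun _ _ => 1) e f) := by
  classical
  have : Finite H.vertexSet := hV
  have hsub : ∀ e ∈ C, e ⊆ H.vertexSet := fun e he =>
    H.subset_vertexSet_of_mem_edgeSet' (h.subset_edgeSet he)
  let v : H.vertexSet := ⟨X 0, hsub _ (h.edge_mem 0) (h.mem 0).1⟩
  have hv : (v : α) ∈ ⋃₀ C := ⟨F 0, h.edge_mem 0, (h.mem 0).1⟩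
  unfold colorCount
  refine Nat.cast_le.2 (Nat.card_le_card_of_injective
    (fun f => ⟨fun x => if (x : α) ∈ ⋃₀ C then f.1 v else f.1 x, fun e he =>
      ⟨f.1 v, fun x hx => if_pos ⟨e, he, hx⟩⟩⟩) ?_)
  intro f g hfg
  have hfg' : ∀ x : H.vertexSet, (if (x : α) ∈ ⋃₀ C then f.1 v else f.1 x) =
      if (x : α) ∈ ⋃₀ C then g.1 v else g.1 x := fun x => congrFun (congrArg Subtype.val hfg) x
  have hfgv : f.1 v = g.1 v := by simpa only [hv, if_true] using hfg' v
  refine Subtype.ext (funext fun x => ?_)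
  by_cases hx : (x : α) ∈ ⋃₀ C
  · exact eq_of_bad π hsub f.2 g.2 (h.edgesConnected v hv x hx) hfgv
  · simpa only [hx, if_false] using hfg' x

theorem exists_colorCount_bad_eq_zero (h : UniqueCycle H p C F X) {k : ℕ} (hk : 2 ≤ k) :
    ∃ π : Set α → H.vertexSet → Equiv.Perm (Fin k),
      colorCount (fun f : H.vertexSet → Fin k => ∀ e ∈ C, Bad π e f) = 0 := by
  classical
  have hp := h.three_le
  obtain ⟨k, rfl⟩ : ∃ j, k = j + 2 := ⟨k - 2, by omega⟩
  have hsub : ∀ e ∈ C, e ⊆ H.vertexSet := fun e he =>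
    H.subset_vertexSet_of_mem_edgeSet' (h.subset_edgeSet he)
  -- A single cyclic shift, at the vertex `X (p - 1)` of `F (p - 1)`. Badness on the other edges
  -- makes `X (p - 2)` and `X (p - 1)` equal in color, whereas badness on `F (p - 1)` makes them
  -- differ by `1`, which is nonzero as there are at least two colors.
  refine ⟨fun e x => if e = F (p - 1) ∧ (x : α) = X (p - 1) then Equiv.addRight 1 else 1, ?_⟩
  unfold colorCount
  rw [Nat.cast_eq_zero]
  refine @Nat.card_of_isEmpty _ ⟨fun ⟨f, hf⟩ => ?_⟩
  obtain ⟨⟨hw, hw'⟩, hv, hv'⟩ : (X (p - 2) ∈ F (p - 1) ∧ X (p - 2) ∈ ⋃₀ (C \ {F (p - 1)})) ∧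
      X (p - 1) ∈ F (p - 1) ∧ X (p - 1) ∈ ⋃₀ (C \ {F (p - 1)}) := by
    have hX2 := h.mem (p - 2)
    rw [show p - 2 + 1 = p - 1 by omega] at hX2
    have hX1 := h.mem (p - 1)
    have hmem : F (p - 1 + 1) ∈ C \ {F (p - 1)} := by
      rw [h.diff_eq (by omega)]; exact ⟨0, by simp, by simp⟩
    refine ⟨⟨hX2.2, F (p - 2), ⟨h.edge_mem _, fun heq => ?_⟩, hX2.1⟩, hX1.1, _, hmem, hX1.2⟩
    have := h.injOn (show p - 2 < p by omega) (show p - 1 < p by omega) heq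
    omega
  let v : H.vertexSet := ⟨X (p - 1), hsub _ (h.edge_mem _) hv⟩
  let w : H.vertexSet := ⟨X (p - 2), hsub _ (h.edge_mem _) hw⟩
  have heq : f v = f w := by
    have hconst : ∀ e ∈ C \ {F (p - 1)}, Bad (fun _ _ => 1) e f := by
      rintro e ⟨he, hne⟩
      obtain ⟨j, hj⟩ := hf e he
      refine ⟨j, fun x hx => ?_⟩
      rw [hj x hx]
      dsimp only
      rw [if_neg fun hh => hne hh.1]
    refine (eq_of_bad (x := v) (y := w) (g := fun _ => f v) (fun _ _ => 1)
      (fun e he => hsub e he.1) hconst (fun e _ => ⟨f v, fun _ _ => rfl⟩)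
      (h.edgesConnected_diff (i := p - 1) (by omega) _ hv' _ hw') rfl).symm
  obtain ⟨j, hj⟩ := hf _ (h.edge_mem (p - 1))
  have h1 := hj v hv
  have h2 := hj w hw
  dsimp only at h1 h2
  rw [if_pos ⟨rfl, rfl⟩] at h1
  rw [if_neg fun hh => h.vertex_ne hh.2] at h2
  rw [h1, h2] at heq
  simp at heq

end UniqueCycle

/-! ### Reduction to permutation covers -/

/-- Members with domain `e` are disjoint, so they take distinct colors at each vertex of `e`.
Labeling each by its color at a reference vertex of `e`, the partial injection from labels to colors
at `x` extends to a permutation. -/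
theorem IsCover.exists_perm {H : Hypergraph α} {k : ℕ} (hk : 0 < k)
    (hne : ∀ e ∈ H.edgeSet, e.Nonempty) {F : Set (H.vertexSet →. Fin k)} (hF : H.IsCover k F) :
    ∃ π : Set α → H.vertexSet → Equiv.Perm (Fin k), ∀ f : H.vertexSet → Fin k,
      (∀ e ∈ H.edgeSet, ¬ Bad π e f) → H.IsCoverColoring F f := by
  have hval : ∀ (φ : H.vertexSet →. Fin k) x, ∃ c, x ∈ φ.Dom → c ∈ φ x := by
    intro φ x
    by_cases hx : x ∈ φ.Dom
    · exact ⟨(φ x).get hx, fun _ => Part.get_mem hx⟩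
    · exact ⟨⟨0, hk⟩, fun h => absurd h hx⟩
  choose c hc using hval
  have hdom : ∀ (φ : H.vertexSet →. Fin k) e, Subtype.val '' φ.Dom = e →
      ∀ x : H.vertexSet, (x : α) ∈ e ↔ x ∈ φ.Dom := by
    rintro φ e rfl x
    exact Subtype.val_injective.mem_set_image
  have hinj : ∀ e, ∀ x : H.vertexSet, (x : α) ∈ e → Function.Injective
      fun φ : {φ // φ ∈ F ∧ Subtype.val '' φ.Dom = e} => c φ.1 x := by
    rintro e x hx ⟨φ, hφ, hφe⟩ ⟨ψ, hψ, hψe⟩ heq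
    by_contra hne
    have hdisj := hF.2 φ hφ ψ hψ (fun h => hne (Subtype.ext h))
      (Subtype.val_injective.image_injective (hφe.trans hψe.symm))
    have hmem : (x, c φ x) ∈ φ.graph := hc φ x ((hdom φ e hφe x).1 hx)
    refine Set.disjoint_left.1 hdisj hmem ?_
    change c φ x ∈ ψ x
    rw [show c φ x = c ψ x from heq]
    exact hc ψ x ((hdom ψ e hψe x).1 hx)
  -- The reference vertex is the chosen element of `e`; it must not depend on `x`.
  have hperm : ∀ e (x : H.vertexSet), ∃ σ : Equiv.Perm (Fin k), e ∈ H.edgeSet → (x : α) ∈ e →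
      ∀ u : H.vertexSet, (∃ h : e.Nonempty, (u : α) = h.some) →
      ∀ φ ∈ F, Subtype.val '' φ.Dom = e → σ (c φ u) = c φ x := by
    intro e x
    by_cases h : e ∈ H.edgeSet ∧ (x : α) ∈ e
    · have hn := hne e h.1
      let u : H.vertexSet := ⟨hn.some, H.subset_vertexSet_of_mem_edgeSet' h.1 hn.some_mem⟩
      have : Finite {φ // φ ∈ F ∧ Subtype.val '' φ.Dom = e} := Finite.of_injective _ (hinj e x h.2)
      obtain ⟨σ, hσ⟩ := Equiv.Perm.exists_extending_pair _ _ (hinj e u hn.some_mem) (hinj e x h.2)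
      refine ⟨σ, fun _ _ u' ⟨hn', hu'⟩ φ hφ hφe => ?_⟩
      obtain rfl : u' = u := Subtype.ext hu'
      exact hσ ⟨φ, hφ, hφe⟩
    · exact ⟨1, fun h1 h2 => absurd ⟨h1, h2⟩ h⟩
  choose π hπ using hperm
  refine ⟨π, fun f hf φ hφ hext => ?_⟩
  have he := hF.1 φ hφ
  have hn := hne _ he
  refine hf _ he ⟨c φ ⟨hn.some, H.subset_vertexSet_of_mem_edgeSet' he hn.some_mem⟩, fun x hx => ?_⟩
  rw [hπ _ x he hx _ ⟨hn, rfl⟩ φ hφ rfl]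
  exact hext x _ (hc φ x ((hdom φ _ rfl x).1 hx))

theorem exists_isCover {H : Hypergraph α} {k : ℕ}
    (π : Set α → H.vertexSet → Equiv.Perm (Fin k)) :
    ∃ F : Set (H.vertexSet →. Fin k), H.IsCover k F ∧ ∀ f : H.vertexSet → Fin k,
      H.IsCoverColoring F f ↔ ∀ e ∈ H.edgeSet, ¬ Bad π e f := by
  let Φ : Set α → Fin k → (H.vertexSet →. Fin k) := fun e j x => ⟨(x : α) ∈ e, fun _ => π e x j⟩
  have hdom : ∀ e ∈ H.edgeSet, ∀ j, Subtype.val '' (Φ e j).Dom = e := by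
    intro e he j
    ext x
    constructor
    · rintro ⟨y, hy, rfl⟩; exact hy
    · exact fun hx => ⟨⟨x, H.subset_vertexSet_of_mem_edgeSet' he hx⟩, hx, rfl⟩
  refine ⟨{φ | ∃ e ∈ H.edgeSet, ∃ j, φ = Φ e j}, ⟨?_, ?_⟩, fun f => ?_⟩
  · rintro _ ⟨e, he, j, rfl⟩
    rw [hdom e he j]; exact he
  · rintro _ ⟨e, he, j, rfl⟩ _ ⟨e', he', j', rfl⟩ hne heq
    obtain rfl : e = e' := by rw [← hdom e he j, ← hdom e' he' j', heq]
    rw [Set.disjoint_left]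
    rintro ⟨x, d⟩ ⟨hx, h1⟩ ⟨hx', h2⟩
    have hj : π e x j = π e x j' := h1.trans h2.symm
    exact hne (congrArg (Φ e) ((π e x).injective hj))
  · constructor
    · rintro h e he ⟨j, hj⟩
      refine h _ ⟨e, he, j, rfl⟩ ?_
      rintro x d ⟨hx, rfl⟩
      exact hj x hx
    · rintro h _ ⟨e, he, j, rfl⟩ hext
      exact h e he ⟨j, fun x hx => hext x _ ⟨hx, rfl⟩⟩

theorem isProperColoring_iff {H : Hypergraph α} {k : ℕ} (hne : ∀ e ∈ H.edgeSet, e.Nonempty)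
    (f : H.vertexSet → Fin k) :
    H.IsProperColoring f ↔ ∀ e ∈ H.edgeSet, ¬ Bad (fun _ _ => 1) e f := by
  refine forall₂_congr fun e he => ?_
  constructor
  · rintro ⟨u, v, hu, hv, huv⟩ ⟨j, hj⟩
    exact huv ((hj u hu).trans (hj v hv).symm)
  · intro h
    by_contra! hcon
    obtain ⟨u, hu⟩ := hne e he
    exact h ⟨f ⟨u, H.subset_vertexSet_of_mem_edgeSet' he hu⟩, fun x hx => hcon _ _ hx hu⟩

/-- A permutation cover with the fewest colorings determines the DP color function. -/
theorem dpColorFunction_eq {H : Hypergraph α} (hV : H.vertexSet.Finite) {k : ℕ} (hk : 0 < k)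
    (hne : ∀ e ∈ H.edgeSet, e.Nonempty) (π : Set α → H.vertexSet → Equiv.Perm (Fin k))
    (hmin : ∀ ρ : Set α → H.vertexSet → Equiv.Perm (Fin k),
      colorCount (fun f : H.vertexSet → Fin k => ∀ e ∈ H.edgeSet, ¬ Bad π e f) ≤
        colorCount (fun f : H.vertexSet → Fin k => ∀ e ∈ H.edgeSet, ¬ Bad ρ e f)) :
    (H.dpColorFunction k : ℚ) =
      colorCount (fun f : H.vertexSet → Fin k => ∀ e ∈ H.edgeSet, ¬ Bad π e f) := by
  have : Finite H.vertexSet := hV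
  have hcount : ∀ F, (H.coverColoringCount F : ℚ) =
    colorCount (fun f : H.vertexSet → Fin k => H.IsCoverColoring F f) := fun F => rfl
  obtain ⟨⟨F, hF, hn⟩, hle⟩ := H.dpColorFunction_isLeast k
  apply le_antisymm
  · obtain ⟨G, hG, hGf⟩ := exists_isCover π
    rw [← colorCount_congr hGf, ← hcount]
    exact_mod_cast hle ⟨G, hG, rfl⟩
  · obtain ⟨ρ, hρ⟩ := hF.exists_perm hk hne
    refine (hmin ρ).trans ?_
    rw [hn]
    exact Nat.cast_le.2 (Nat.card_le_card_of_injective (Subtype.map id hρ)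
      (Subtype.map_injective hρ Function.injective_id))

end Hypergraph

/-! ### The theorem -/

theorem mainTheorem2 {α : Type*} (H : Hypergraph α) (hfin : H.vertexSet.Finite)
    (r m p : ℕ) (hr : 3 ≤ r) (hp : 3 ≤ p)
    (hunif : H.IsUniform r) (hlin : H.IsLinear) (huni : H.IsUnicyclic)
    (C : Set (Set α)) (hC : H.IsCycle p C) (hcard : H.edgeSet.ncard = m + p) :
    (Odd p → ∀ k : ℕ, H.dpColorFunction k = H.chromaticFunction k) ∧
    (Even p → ∀ k : ℕ, ¬ (k = 1 ∧ m = 0) →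
      (H.dpColorFunction k : ℤ) =
        ((k : ℤ) ^ (r - 1) - 1) ^ (m + p) - ((k : ℤ) ^ (r - 1) - 1) ^ m) := by
  have : Finite H.vertexSet := hfin
  have hne : ∀ e ∈ H.edgeSet, e.Nonempty := by
    intro e he
    rw [← Set.encard_pos, hunif e he]; exact_mod_cast (by omega : 0 < r)
  obtain ⟨F, X, hF, hX, hFE, hXF, hCF⟩ := hC.exists_nat
  have h : H.UniqueCycle p C F X := ⟨hp, hF, hX, hFE, hXF, hCF,
    fun l C' hC' => huni.2.unique ⟨l, hC'⟩ ⟨p, hC⟩⟩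
  have hcon : Hypergraph.EdgesConnected H.edgeSet := by
    rintro x ⟨e, he, hx⟩ y ⟨f, hf, hy⟩
    exact huni.1.joined (H.subset_vertexSet_of_mem_edgeSet' he hx)
      (H.subset_vertexSet_of_mem_edgeSet' hf hy)
  have hXV : ∀ i, X i ∈ H.vertexSet := fun i =>
    H.subset_vertexSet_of_mem_edgeSet' (hFE i) (hXF i).1
  have hcov : ⋃₀ H.edgeSet = H.vertexSet := by
    refine Set.Subset.antisymm
      (Set.sUnion_subset fun e he => H.subset_vertexSet_of_mem_edgeSet' he) fun x hx => ?_
    by_cases hx0 : x = X 0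
    · exact ⟨F 0, hFE 0, hx0 ▸ (hXF 0).1⟩
    · obtain ⟨P, hP, ⟨e, he, hxe⟩, -⟩ := huni.1 x hx (X 0) (hXV 0) hx0
      exact ⟨e, hP.1 e he, hxe⟩
  -- Zero colors are set apart because the counting divides by `k`; the vertex `X 0` then excludes
  -- every map.
  have hzero : H.dpColorFunction 0 = 0 ∧ H.chromaticFunction 0 = 0 := by
    have hE : IsEmpty (H.vertexSet → Fin 0) := ⟨fun f => (f ⟨X 0, hXV 0⟩).elim0⟩
    obtain ⟨⟨G, hG, hn⟩, -⟩ := H.dpColorFunction_isLeast 0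
    rw [hn]
    unfold Hypergraph.coverColoringCount Hypergraph.chromaticFunction
    exact ⟨@Nat.card_of_isEmpty _ ⟨fun f => hE.false f.1⟩,
      @Nat.card_of_isEmpty _ ⟨fun f => hE.false f.1⟩⟩
  have hq : ∀ k : ℕ, 0 < k → 0 ≤ 1 - ((k : ℚ) ^ (r - 1))⁻¹ := by
    intro k hk
    have : (1 : ℚ) ≤ (k : ℚ) ^ (r - 1) := one_le_pow₀ (by exact_mod_cast hk)
    linarith [inv_le_one_of_one_le₀ this]
  constructor
  · intro hodd k
    rcases Nat.eq_zero_or_pos k with rfl | hk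
    · rw [hzero.1, hzero.2]
    · have hform := h.colorCount_eq hfin hk hunif (by omega) hlin hcon hcard
      have hdp := Hypergraph.dpColorFunction_eq hfin hk hne (fun _ _ => 1) fun ρ => by
        rw [hform, hform ρ, hodd.neg_one_pow]
        refine mul_le_mul_of_nonneg_left ?_ (pow_nonneg (hq k hk) m)
        linarith [h.colorCount_bad_le hfin ρ]
      rw [← Hypergraph.colorCount_congr (Hypergraph.isProperColoring_iff hne)] at hdp
      exact Nat.cast_injective (R := ℚ) hdp
  · intro heven k hkm
    rcases Nat.eq_zero_or_pos k with rfl | hk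
    · rw [hzero.1]
      simp [show r - 1 ≠ 0 by omega, pow_add, heven.neg_one_pow]
    · have hform := h.colorCount_eq hfin hk hunif (by omega) hlin hcon hcard
      have hn := h.card_vertexSet hfin hunif (by omega) hlin hcon hcov hcard
      have hk0 : (k : ℚ) ^ (r - 1) ≠ 0 := pow_ne_zero _ (by exact_mod_cast hk.ne')
      -- Only the product has to vanish. For `k = 1` every coloring is bad on the cycle, but then `1
      -- - q = 0`, and this suffices since `m ≠ 0`.
      obtain ⟨π, hπ⟩ : ∃ π : Set α → H.vertexSet → Equiv.Perm (Fin k),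
          (1 - ((k : ℚ) ^ (r - 1))⁻¹) ^ m *
            Hypergraph.colorCount (fun f : H.vertexSet → Fin k =>
              ∀ e ∈ C, Hypergraph.Bad π e f) = 0 := by
        rcases Nat.lt_or_ge k 2 with hk2 | hk2
        · obtain rfl : k = 1 := by omega
          have hm : m ≠ 0 := fun hm => hkm ⟨rfl, hm⟩
          exact ⟨fun _ _ => 1, by simp [hm]⟩
        · obtain ⟨π, hπ⟩ := h.exists_colorCount_bad_eq_zero hk2
          exact ⟨π, by rw [hπ, mul_zero]⟩
      have hdp := Hypergraph.dpColorFunction_eq hfin hk hne π fun ρ => by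
        rw [hform, hform ρ, heven.neg_one_pow]
        have := mul_nonneg (pow_nonneg (hq k hk) m)
          (Hypergraph.colorCount_nonneg fun f : H.vertexSet → Fin k =>
            ∀ e ∈ C, Hypergraph.Bad ρ e f)
        linarith
      rw [hform, hn, heven.neg_one_pow] at hdp
      have hQ : (H.dpColorFunction k : ℚ) =
          ((k : ℚ) ^ (r - 1) - 1) ^ (m + p) - ((k : ℚ) ^ (r - 1) - 1) ^ m := by
        rw [pow_mul] at hdp
        set K : ℚ := (k : ℚ) ^ (r - 1)
        have h1 : K - 1 = K * (1 - K⁻¹) := by rw [mul_sub, mul_inv_cancel₀ hk0, mul_one]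
        have h2 : K ^ p * K⁻¹ ^ p = 1 := by rw [← mul_pow, mul_inv_cancel₀ hk0, one_pow]
        rw [hdp, h1, mul_pow, mul_pow, pow_add, pow_add]
        -- By `hn`, `N = K ^ (m + p)`, so `N * q ^ p` reduces to `K ^ m`.
        linear_combination hπ - (1 - K⁻¹) ^ m * K ^ m * h2
      exact_mod_cast hQ
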